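/- Consider the $(1:b)$ Maker-Breaker game on the edge set of the complete graph $K_n$, where $b\ge 1$ is an integer: Maker and Breaker alternately claim previously unclaimed edges of $K_n$, with Maker moving first; in each round Maker claims one edge and then Breaker claims $b$ edges (or all remaining edges if fewer than $b$ remain), until all edges have been claimed. For every $0<\varepsilon<1$ there exist $\delta=\delta(\varepsilon)>0$ and $n_0=n_0(\varepsilon)$ such that for all $n>n_0$ and all integers $b$ with $1\le b\le (1-\varepsilon)n/2$, Maker has a strategy in this game which guarantees, however Breaker plays, that the graph formed by Maker's edges at the end of the game contains a cycle of length at least $\delta n$. -/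

import Mathlib

namespace MakerBreaker

/-- One round of the game: the edge claimed by Maker, followed by the set of edges claimed by
Breaker in reply. -/
abbrev Round (n : ℕ) : Type := Sym2 (Fin n) × Finset (Sym2 (Fin n))

/-- A sequence of rounds, the most recent round first. -/
abbrev History (n : ℕ) : Type := List (Round n)

/-- The edges claimed by Maker so far. -/
def makerEdges {n : ℕ} : History n → Finset (Sym2 (Fin n))
  | [] => ∅
  | r :: h => insert r.1 (makerEdges h)

/-- The edges claimed by Breaker so far. -/
def breakerEdges {n : ℕ} : History n → Finset (Sym2 (Fin n))
  | [] => ∅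
  | r :: h => r.2 ∪ breakerEdges h

/-- The edges of the complete graph on `n` vertices that nobody has claimed yet. -/
def freeEdges {n : ℕ} (h : History n) : Finset (Sym2 (Fin n)) :=
  (⊤ : SimpleGraph (Fin n)).edgeFinset \ (makerEdges h ∪ breakerEdges h)

/-- `IsPlay b h`: the sequence of rounds `h` obeys the rules of the `(1 : b)` game. In each round
Maker, who moves first, claims one free edge; then Breaker claims exactly `b` of the edges that are
still free, or all of them if fewer than `b` are left. -/
inductive IsPlay {n : ℕ} (b : ℕ) : History n → Prop
  | nil : IsPlay b []
  | cons {h : History n} {e : Sym2 (Fin n)} {B : Finset (Sym2 (Fin n))}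
      (play : IsPlay b h)
      (maker_legal : e ∈ freeEdges h)
      (breaker_legal : B ⊆ (freeEdges h).erase e)
      (breaker_card : B.card = min b ((freeEdges h).erase e).card) :
      IsPlay b ((e, B) :: h)

/-- The play is over: all edges have been claimed. -/
def IsOver {n : ℕ} (h : History n) : Prop := freeEdges h = ∅

/-- A strategy of Maker in the `(1 : b)` game: after every play that is not over, it tells Maker
which free edge to claim next (its values at other histories are irrelevant). -/
structure MakerStrategy (n b : ℕ) where
  /-- the edge to claim after the given history -/
  move : History n → Sym2 (Fin n)
  move_mem : ∀ h : History n, IsPlay b h → ¬ IsOver h → move h ∈ freeEdges h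

/-- In every round of the history, Maker's move was the one prescribed by the strategy `σ`. -/
def MakerStrategy.Follows {n b : ℕ} (σ : MakerStrategy n b) : History n → Prop
  | [] => True
  | r :: h => r.1 = σ.move h ∧ σ.Follows h

/-- The graph on the vertex set `Fin n` formed by Maker's edges. -/
def makerGraph {n : ℕ} (h : History n) : SimpleGraph (Fin n) :=
  SimpleGraph.fromEdgeSet (makerEdges h : Set (Sym2 (Fin n)))

/-- Maker has a strategy in the `(1 : b)` game on the edges of the complete graph on `n` vertices
which guarantees, however Breaker plays, that his graph at the end of the game satisfies `P`. -/
def MakerWins (n b : ℕ) (P : SimpleGraph (Fin n) → Prop) : Prop :=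
  ∃ σ : MakerStrategy n b, ∀ h : History n,
    IsPlay b h → IsOver h → σ.Follows h → P (makerGraph h)

/-- The graph `G` contains a cycle of length at least `L`. -/
def HasCycleOfLengthAtLeast {V : Type*} (G : SimpleGraph V) (L : ℝ) : Prop :=
  ∃ (v : V) (p : G.Walk v v), p.IsCycle ∧ L ≤ (p.length : ℝ)

end MakerBreaker

/-! Suppose Maker picks uniformly random free edges for `T`, about `(1 + ε/2) n`, rounds. The bound
on `b` keeps at least `ε n² / 8` edges free, so a given pair is claimed with probability
`O(1/(εn))`. By a union bound it is likely that every set of `k ≤ β n` vertices spans at most `(1 +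
1/Q) k` of Maker's edges. Conditional expectations make this deterministic: some free edge never
increases `dangerPotential`, whatever Breaker has done.

The resulting graph has average density at least `1 + ε/2` but local density at most `1 + ε/8`. If
it had no long cycle, depth-first search would give small separators (`exists_separation`). Peeling
off small pieces along them carries the local bound to the whole graph with only a slightly larger
constant (`card_edges_le_of_no_long_cycle`), a contradiction. -/

namespace MakerBreaker

/-! ### Averaging for the danger potential -/

section Potential

variable {α ι : Type*} [DecidableEq α]

/-- The potential of a set `M` of claimed elements with respect to a family `F` of sets that
should not be claimed entirely: an upper bound for the expected number of members that get
claimed, if each unclaimed element is still claimed with probability at most `x`. -/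
def dangerPotential (I : Finset ι) (F : ι → Finset α) (x : ℝ) (M : Finset α) : ℝ :=
  ∑ i ∈ I, x ^ (F i \ M).card

theorem pow_add_mul_le_add_pow {x q : ℝ} (hx : 0 ≤ x) (hq : 0 ≤ q) (r : ℕ) :
    x ^ (r + 1) + (r + 1) * q * x ^ r ≤ (x + q) ^ (r + 1) := by
  induction r with
  | zero => simp
  | succ r ih =>
    have h1 := mul_le_mul_of_nonneg_right ih (add_nonneg hx hq)
    have h2 : 0 ≤ ((r : ℝ) + 1) * q ^ 2 * x ^ r := by positivity
    rw [pow_succ (x + q)]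
    refine le_trans ?_ h1
    push_cast
    have h3 : (x ^ (r + 1) + (r + 1) * q * x ^ r) * (x + q) =
        x ^ (r + 1 + 1) + (r + 1 + 1) * q * x ^ (r + 1) + (r + 1) * q ^ 2 * x ^ r := by ring
    linarith

/-- A uniformly random element of `S` hits the `r + 1` missing elements with probability at most `(r
+ 1) q`, and a hit lowers the exponent by one. The average is thus at most the first two binomial
terms of `(x + q) ^ (r + 1)`. -/
theorem sum_pow_card_sdiff_insert_le {q x : ℝ} (hq : 0 ≤ q) (hx : 0 ≤ x)
    (A M S : Finset α) (hS : 1 ≤ q * S.card) :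
    ∑ e ∈ S, x ^ (A \ insert e M).card ≤ S.card * (x + q) ^ (A \ M).card := by
  obtain hr | ⟨r, hr⟩ : (A \ M).card = 0 ∨ ∃ r, (A \ M).card = r + 1 := by
    cases h : (A \ M).card <;> simp
  · have h0 : ∀ e, (A \ insert e M).card = 0 := fun e =>
      Nat.le_zero.1 (hr ▸ Finset.card_le_card
        (Finset.sdiff_subset_sdiff (Finset.Subset.refl A) (Finset.subset_insert e M)))
    simp [hr, h0]
  have hterm : ∀ e ∈ S, x ^ (A \ insert e M).card ≤
      x ^ (r + 1) + if e ∈ A \ M then x ^ r else 0 := by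
    intro e _
    have heq : A \ insert e M = (A \ M).erase e := by
      ext y
      simp only [Finset.mem_sdiff, Finset.mem_insert, Finset.mem_erase]
      tauto
    rw [heq]
    split_ifs with he
    · rw [Finset.card_erase_of_mem he, hr, Nat.add_sub_cancel]
      exact le_add_of_nonneg_left (by positivity)
    · rw [Finset.erase_eq_of_notMem he, hr, add_zero]
  refine (Finset.sum_le_sum hterm).trans ?_
  rw [Finset.sum_add_distrib, Finset.sum_const, nsmul_eq_mul, ← Finset.sum_filter,
    Finset.sum_const, nsmul_eq_mul, hr]
  have hcard : ((S.filter fun e => e ∈ A \ M).card : ℝ) ≤ (r + 1 : ℝ) := by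
    have : (S.filter fun e => e ∈ A \ M).card ≤ (A \ M).card :=
      Finset.card_le_card fun e he => (Finset.mem_filter.1 he).2
    rw [hr] at this
    exact_mod_cast this
  have hxr : 0 ≤ x ^ r := by positivity
  have h1 := mul_le_mul_of_nonneg_left (pow_add_mul_le_add_pow hx hq r) (Nat.cast_nonneg S.card)
  have h2 := mul_le_mul_of_nonneg_right hcard hxr
  have h3 : (r + 1 : ℝ) * x ^ r ≤ (q * S.card) * ((r + 1 : ℝ) * x ^ r) :=
    le_mul_of_one_le_left (by positivity) hS
  linarith

theorem exists_insert_dangerPotential_le (I : Finset ι) (F : ι → Finset α) {q x : ℝ}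
    (hq : 0 ≤ q) (hx : 0 ≤ x) (M S : Finset α) (hS : 1 ≤ q * S.card) :
    ∃ e ∈ S, dangerPotential I F x (insert e M) ≤ dangerPotential I F (x + q) M := by
  have hne : S.Nonempty := by
    rw [Finset.nonempty_iff_ne_empty]
    rintro rfl
    norm_num at hS
  refine Finset.exists_le_of_sum_le hne ?_
  simp only [dangerPotential]
  rw [Finset.sum_comm, Finset.sum_const, nsmul_eq_mul, Finset.mul_sum]
  exact Finset.sum_le_sum fun i _ => sum_pow_card_sdiff_insert_le hq hx (F i) M S hS

end Potential

/-! ### Edge counts and the derandomised strategy -/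

section Play

variable {n b : ℕ}

theorem not_isDiag_of_mem_makerEdges {h : History n} (hp : IsPlay b h) :
    ∀ e ∈ makerEdges h, ¬ e.IsDiag := by
  induction hp with
  | nil => simp [makerEdges]
  | cons play he _ _ ih =>
    intro e' he'
    rw [makerEdges, Finset.mem_insert] at he'
    rcases he' with rfl | he'
    · have := (Finset.mem_sdiff.1 he).1
      simpa using this
    · exact ih e' he'

theorem card_makerEdges {h : History n} (hp : IsPlay b h) : (makerEdges h).card = h.length := by
  induction hp with
  | nil => simp [makerEdges]
  | cons play he _ _ ih =>
    rw [makerEdges, Finset.card_insert_of_notMem, ih, List.length_cons]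
    intro hmem
    exact (Finset.mem_sdiff.1 he).2 (Finset.mem_union_left _ hmem)

theorem card_breakerEdges_le {h : History n} (hp : IsPlay b h) :
    (breakerEdges h).card ≤ b * h.length := by
  induction hp with
  | nil => simp [breakerEdges]
  | cons play _ _ hB ih =>
    rw [breakerEdges, List.length_cons, mul_add, mul_one]
    refine (Finset.card_union_le _ _).trans ?_
    have := hB.trans_le (min_le_left _ _)
    exact (add_le_add this ih).trans_eq (add_comm _ _)

theorem choose_two_le_card_freeEdges_add {h : History n} (hp : IsPlay b h) :
    n.choose 2 ≤ (freeEdges h).card + (b + 1) * h.length := by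
  have h1 : ((⊤ : SimpleGraph (Fin n)).edgeFinset).card = n.choose 2 := by
    rw [SimpleGraph.card_edgeFinset_top_eq_card_choose_two, Fintype.card_fin]
  have h2 := Finset.le_card_sdiff (makerEdges h ∪ breakerEdges h)
    ((⊤ : SimpleGraph (Fin n)).edgeFinset)
  have h3 := Finset.card_union_le (makerEdges h) (breakerEdges h)
  have h4 := card_makerEdges hp
  have h5 := card_breakerEdges_le hp
  rw [freeEdges]
  rw [add_mul, one_mul]
  omega

theorem IsPlay.drop {h : History n} (hp : IsPlay b h) (k : ℕ) : IsPlay b (h.drop k) := by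
  induction hp generalizing k with
  | nil => simpa using IsPlay.nil
  | cons play he hB hc ih =>
    cases k with
    | zero => exact IsPlay.cons play he hB hc
    | succ k => exact ih k

theorem MakerStrategy.Follows.drop {σ : MakerStrategy n b} {h : History n} (hf : σ.Follows h)
    (k : ℕ) : σ.Follows (h.drop k) := by
  induction h generalizing k with
  | nil => simp [MakerStrategy.Follows]
  | cons r h ih =>
    cases k with
    | zero => exact hf
    | succ k => exact ih hf.2 k

theorem makerEdges_drop_subset (h : History n) (k : ℕ) : makerEdges (h.drop k) ⊆ makerEdges h := by
  induction h generalizing k with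
  | nil => simp
  | cons r h ih =>
    cases k with
    | zero => exact Finset.Subset.refl _
    | succ k => exact (ih k).trans (Finset.subset_insert _ _)

/-- If enough edges are free during the first `T` rounds, Maker can keep the potential from
growing. -/
theorem exists_strategy_dangerPotential_le {ι : Type*} (I : Finset ι)
    (F : ι → Finset (Sym2 (Fin n))) (hn : 0 < n) {q : ℝ} (hq : 0 ≤ q) (T : ℕ)
    (hfree : ∀ h : History n, IsPlay b h → h.length < T → 1 ≤ q * (freeEdges h).card) :
    ∃ σ : MakerStrategy n b, ∀ h : History n, IsPlay b h → σ.Follows h → h.length ≤ T →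
      dangerPotential I F ((T - h.length : ℕ) * q) (makerEdges h) ≤
        dangerPotential I F (T * q) ∅ := by
  have hmove : ∀ h : History n, ∃ e : Sym2 (Fin n), IsPlay b h → ¬ IsOver h →
      e ∈ freeEdges h ∧ (h.length < T →
        dangerPotential I F ((T - (h.length + 1) : ℕ) * q) (insert e (makerEdges h)) ≤
          dangerPotential I F ((T - h.length : ℕ) * q) (makerEdges h)) := by
    intro h
    by_cases hp : IsPlay b h ∧ ¬ IsOver h
    · by_cases hT : h.length < T
      -- The parameter is `q` times the number of rounds left after this one; the averaging step
      -- pays exactly one `q`.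
      · obtain ⟨e, he, hle⟩ := exists_insert_dangerPotential_le I F hq
          (x := (T - (h.length + 1) : ℕ) * q) (by positivity) (makerEdges h) (freeEdges h)
          (hfree h hp.1 hT)
        refine ⟨e, fun _ _ => ⟨he, fun _ => hle.trans_eq ?_⟩⟩
        congr 1
        rw [show T - h.length = T - (h.length + 1) + 1 by omega]
        push_cast
        ring
      · obtain ⟨e, he⟩ := Finset.nonempty_iff_ne_empty.2 hp.2
        exact ⟨e, fun _ _ => ⟨he, fun h => absurd h hT⟩⟩
    · exact ⟨s(⟨0, hn⟩, ⟨0, hn⟩), fun h1 h2 => absurd ⟨h1, h2⟩ hp⟩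
  choose move hmove using hmove
  refine ⟨⟨move, fun h h1 h2 => (hmove h h1 h2).1⟩, fun h hp => ?_⟩
  induction hp with
  | nil => intros; simp [makerEdges]
  | @cons h e B play he _ _ ih =>
    intro hf hT
    rw [List.length_cons] at hT
    have hover : ¬ IsOver h := fun ho => by
      rw [IsOver] at ho
      simp [ho] at he
    have hlt := (hmove h play hover).2 (by omega)
    have he' : e = move h := hf.1
    rw [makerEdges, List.length_cons, he']
    exact hlt.trans (ih hf.2 (by omega))

end Play

/-! ### Union bound over dense vertex sets -/

section UnionBound

/-- The initial potential of the family of all sets of `k + j` pairs inside `k`-sets of vertices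
is exponentially small in `k`. -/
theorem choose_mul_choose_mul_pow_le {n k j Q : ℕ} {K y : ℝ} (hn : 0 < n) (hk : 0 < k)
    (hK : 1 ≤ K) (hy : y * (36 * K) = 1) (hj : k ≤ Q * j)
    (hkn : (k : ℝ) ≤ y ^ Q / K * n) :
    (n.choose k : ℝ) * (((k + 1).choose 2).choose (k + j) : ℝ) * (K / n) ^ (k + j) ≤
      (1 / 4) ^ k := by
  have hn' : (0 : ℝ) < n := by exact_mod_cast hn
  have hk' : (0 : ℝ) < k := by exact_mod_cast hk
  have hK0 : 0 < K := by linarith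
  have hy0 : 0 < y := by
    by_contra! h
    nlinarith
  have hy1 : y ≤ 1 := by nlinarith
  have hexp : ∀ m : ℕ, (k : ℝ) ^ m / m.factorial ≤ 3 ^ k := fun m => by
    refine (Real.pow_div_factorial_le_exp (k : ℝ) (Nat.cast_nonneg k) m).trans ?_
    rw [← Real.exp_one_pow]
    gcongr
    exact Real.exp_one_lt_three.le
  have h1 : (n.choose k : ℝ) * k ^ k ≤ 3 ^ k * n ^ k := by
    have := Nat.choose_le_pow_div (α := ℝ) k n
    calc (n.choose k : ℝ) * k ^ k ≤ n ^ k / k.factorial * k ^ k := by gcongr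
      _ = (k : ℝ) ^ k / k.factorial * n ^ k := by ring
      _ ≤ 3 ^ k * n ^ k := by gcongr; exact hexp k
  have h2 : (((k + 1).choose 2).choose (k + j) : ℝ) ≤ k ^ (k + j) * 3 ^ k := by
    have hc : (((k + 1).choose 2 : ℕ) : ℝ) ≤ k * k := by
      rw [Nat.cast_choose_two]
      push_cast
      have : (1 : ℝ) ≤ k := by exact_mod_cast hk
      nlinarith
    calc (((k + 1).choose 2).choose (k + j) : ℝ)
        ≤ (((k + 1).choose 2 : ℕ) : ℝ) ^ (k + j) / (k + j).factorial :=
          Nat.choose_le_pow_div _ _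
      _ ≤ (k * k : ℝ) ^ (k + j) / (k + j).factorial := by gcongr
      _ = k ^ (k + j) * ((k : ℝ) ^ (k + j) / (k + j).factorial) := by rw [mul_pow]; ring
      _ ≤ k ^ (k + j) * 3 ^ k := by gcongr; exact hexp _
  -- The surplus `j ≥ k / Q` of pairs over vertices yields the small factor that beats the
  -- exponential constants.
  have h3 : (K * k / n) ^ j ≤ y ^ k := by
    have : K * k / n ≤ y ^ Q := by
      rw [div_le_iff₀ hn']
      calc K * k ≤ K * (y ^ Q / K * n) := by gcongr
        _ = y ^ Q * n := by field_simp
    calc (K * k / n) ^ j ≤ (y ^ Q) ^ j := by gcongr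
      _ = y ^ (Q * j) := (pow_mul _ _ _).symm
      _ ≤ y ^ k := pow_le_pow_of_le_one hy0.le hy1 hj
  calc (n.choose k : ℝ) * (((k + 1).choose 2).choose (k + j) : ℝ) * (K / n) ^ (k + j)
      ≤ n.choose k * (k ^ (k + j) * 3 ^ k) * (K / n) ^ (k + j) := by gcongr
    _ = n.choose k * k ^ k * (k ^ j * 3 ^ k * (K / n) ^ (k + j)) := by ring
    _ ≤ 3 ^ k * n ^ k * (k ^ j * 3 ^ k * (K / n) ^ (k + j)) := by gcongr
    _ = (3 * 3 * K) ^ k * (K * k / n) ^ j := by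
        simp only [div_pow, mul_pow, pow_add]
        field_simp
    _ ≤ (3 * 3 * K) ^ k * y ^ k := by gcongr
    -- The constant 36 in `hy` is chosen so that `9 * K * y = 1 / 4`.
    _ = (1 / 4) ^ k := by
        rw [← mul_pow]
        congr 1
        linarith

end UnionBound

/-! ### Small separators in graphs without long cycles -/

section Separation

variable {V : Type*}

/-- A path `q` from `x` to `z` and a disjoint path `p` from `w` to `u`, closed up by the edges
`zw` and `ux`. -/
theorem exists_cycle_of_two_paths {G : SimpleGraph V} {x z w u : V} (q : G.Walk x z)
    (p : G.Walk w u) (hq : q.IsPath) (hp : p.IsPath) (hd : ∀ v ∈ q.support, v ∉ p.support)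
    (hzw : G.Adj z w) (hux : G.Adj u x) (huw : u ≠ w) :
    ∃ c : G.Walk u u, c.IsCycle ∧ c.length = q.length + p.length + 2 := by
  refine ⟨SimpleGraph.Walk.cons hux (q.append (SimpleGraph.Walk.cons hzw p)), ?_, ?_⟩
  · rw [SimpleGraph.Walk.cons_isCycle_iff]
    constructor
    · rw [SimpleGraph.Walk.isPath_def, SimpleGraph.Walk.support_append, List.nodup_append]
      simp only [SimpleGraph.Walk.support_cons, List.tail_cons]
      exact ⟨hq.support_nodup, hp.support_nodup, fun a ha b hb hab => hd a ha (hab ▸ hb)⟩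
    · intro hmem
      rw [SimpleGraph.Walk.edges_append, List.mem_append, SimpleGraph.Walk.edges_cons,
        List.mem_cons] at hmem
      rcases hmem with h | h | h
      · exact hd u (q.fst_mem_support_of_mem_edges h) p.end_mem_support
      · rw [Sym2.eq_iff] at h
        rcases h with ⟨h1, _⟩ | ⟨h1, _⟩
        · exact hd u (h1 ▸ q.end_mem_support) p.end_mem_support
        · exact huw h1
      · exact hd x q.start_mem_support (p.snd_mem_support_of_mem_edges h)
  · simp only [SimpleGraph.Walk.length_cons, SimpleGraph.Walk.length_append]
    omega

variable [DecidableEq V]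

/-- Every edge of `G` from `D` to a vertex of `U` ends in `D` or in `S`. -/
def ClosedOff (G : SimpleGraph V) (U : Finset V) (S : Set V) (D : Finset V) : Prop :=
  ∀ x ∈ D, ∀ y ∈ U, G.Adj x y → y ∈ D ∨ y ∈ S

/-- Take `D` of least size. If it has more than `s` vertices and splits into two closed-off parts,
the larger part still has at least `s / 2` vertices, contradicting minimality. -/
theorem exists_closedOff_small_or_irreducible {G : SimpleGraph V} {U C : Finset V} {S : Set V}
    {s : ℕ} (hCU : C ⊆ U) (hC : ClosedOff G U S C) (hdisj : ∀ x ∈ C, x ∉ S)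
    (hs : s ≤ 2 * C.card) :
    ∃ D ⊆ C, ClosedOff G U S D ∧ s ≤ 2 * D.card ∧
      (D.card ≤ s ∨ (s < D.card ∧ ∀ E ⊆ D, E.Nonempty → ClosedOff G U S E → E = D)) := by
  classical
  let 𝒟 := C.powerset.filter fun D => ClosedOff G U S D ∧ s ≤ 2 * D.card
  have hne : 𝒟.Nonempty := ⟨C, by simp [𝒟, hC, hs]⟩
  obtain ⟨D, hD, hmin⟩ := Finset.exists_min_image 𝒟 Finset.card hne
  simp only [𝒟, Finset.mem_filter, Finset.mem_powerset] at hD hmin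
  obtain ⟨hDC, hDc, hDs⟩ := hD
  refine ⟨D, hDC, hDc, hDs, ?_⟩
  by_cases hle : D.card ≤ s
  · exact Or.inl hle
  refine Or.inr ⟨by omega, fun E hED hE hEc => ?_⟩
  by_contra hne'
  have hlt : E.card < D.card := Finset.card_lt_card (lt_of_le_of_ne hED hne')
  have hpos : 0 < E.card := hE.card_pos
  have hsum : (D \ E).card + E.card = D.card := Finset.card_sdiff_add_card_eq_card hED
  have hc' : ClosedOff G U S (D \ E) := by
    intro x hx y hy hxy
    rw [Finset.mem_sdiff] at hx
    rcases hDc x hx.1 y hy hxy with h | h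
    · by_cases hyE : y ∈ E
      · rcases hEc y hyE x (hCU (hDC hx.1)) hxy.symm with h' | h'
        · exact absurd h' hx.2
        · exact absurd h' (hdisj x (hDC hx.1))
      · exact Or.inl (Finset.mem_sdiff.2 ⟨h, hyE⟩)
    · exact Or.inr h
  by_cases h1 : s ≤ 2 * E.card
  · have := hmin E ⟨hED.trans hDC, hEc, h1⟩
    omega
  · have := hmin (D \ E) ⟨Finset.sdiff_subset.trans hDC, hc', by omega⟩
    omega

theorem ClosedOff.erase {G : SimpleGraph V} {U D : Finset V} {S : Set V}
    (hD : ClosedOff G U S D) (w : V) : ClosedOff G U (insert w S) (D.erase w) := by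
  intro x hx y hy hxy
  rcases hD x (Finset.mem_of_mem_erase hx) y hy hxy with h | h
  · by_cases hyw : y = w
    · exact Or.inr (Or.inl hyw)
    · exact Or.inl (Finset.mem_erase.2 ⟨hyw, h⟩)
  · exact Or.inr (Or.inr h)

theorem exists_adj_of_irreducible {G : SimpleGraph V} {U D : Finset V} {S : Set V} {w : V}
    (hw : w ∈ D) (hirr : ∀ E ⊆ D, E.Nonempty → ClosedOff G U S E → E = D)
    {E : Finset V} (hE : E ⊆ D.erase w) (hne : E.Nonempty)
    (hEc : ClosedOff G U (insert w S) E) : ∃ z ∈ E, G.Adj w z := by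
  by_contra! hcon
  have hED : E = D := by
    refine hirr E (hE.trans (Finset.erase_subset _ _)) hne fun x hx y hy hxy => ?_
    rcases hEc x hx y hy hxy with h | h | h
    · exact Or.inl h
    · subst h
      exact absurd hxy.symm (hcon x hx)
    · exact Or.inr h
  subst hED
  exact Finset.notMem_erase w E (hE hw)

/-- Each component of `D` sees the tip `w` of the path. If it also sees a path vertex `u ≠ w`, a
detour through the component closes the segment from `w` to `u` into a cycle, so `u` is near the
tip. -/
theorem closedOff_getVert_of_no_long_cycle {G : SimpleGraph V} {U D : Finset V} {L : ℕ}
    (hL : 0 < L) (hcyc : ∀ (v : V) (c : G.Walk v v), c.IsCycle → c.length < L)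
    {w a : V} (p : G.Walk w a) (hp : p.IsPath)
    (hdisj : ∀ x ∈ D, x ∉ p.support)
    (hD : ClosedOff G U {v | v ∈ p.support} D)
    (hadj : ∀ E ⊆ D, E.Nonempty → ClosedOff G U {v | v ∈ p.support} E → ∃ z ∈ E, G.Adj w z) :
    ClosedOff G U ((Finset.range L).image p.getVert : Finset V) D := by
  classical
  -- `E` below is the part of `D` reachable from `x` inside `D`.
  intro x hx u hu hxu
  rcases hD x hx u hu hxu with h | h
  · exact Or.inl h
  right
  have hup : u ∈ p.support := h
  let E := D.filter fun z => ∃ q : G.Walk x z, ∀ v ∈ q.support, v ∈ D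
  have hxE : x ∈ E := Finset.mem_filter.2 ⟨hx, SimpleGraph.Walk.nil, by simpa using hx⟩
  have hEc : ClosedOff G U {v | v ∈ p.support} E := by
    intro y hy v hv hyv
    obtain ⟨hyD, q, hq⟩ := Finset.mem_filter.1 hy
    rcases hD y hyD v hv hyv with h | h
    · refine Or.inl (Finset.mem_filter.2 ⟨h, q.concat hyv, fun t ht => ?_⟩)
      rw [SimpleGraph.Walk.support_concat, List.mem_append] at ht
      rcases ht with ht | ht
      · exact hq t ht
      · rw [List.mem_singleton] at ht
        exact ht ▸ h
    · exact Or.inr h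
  obtain ⟨z, hzE, hwz⟩ := hadj E (Finset.filter_subset _ _) ⟨x, hxE⟩ hEc
  obtain ⟨_, q, hq⟩ := Finset.mem_filter.1 hzE
  rw [Finset.mem_coe, Finset.mem_image]
  refine ⟨(p.takeUntil u hup).length, ?_, SimpleGraph.Walk.getVert_length_takeUntil hup⟩
  rw [Finset.mem_range]
  by_cases huw : u = w
  · subst huw
    simpa using hL
  obtain ⟨c, hc, hlen⟩ := exists_cycle_of_two_paths q.bypass (p.takeUntil u hup)
    q.bypass_isPath (hp.takeUntil hup)
    (fun v hv hv' => hdisj v (hq v (q.support_bypass_subset_support hv))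
      (p.support_takeUntil_subset_support hup hv')) hwz.symm hxu.symm huw
  have := hcyc u c hc
  omega

/-- Depth-first search that always descends into a part with at least `s / 2` vertices. The
invariant is that every nonempty closed-off subset of `C` sees the tip `w`; irreducibility of `D`
preserves it when the path is extended into `D`. -/
theorem exists_separation_of_path {G : SimpleGraph V} {U : Finset V} {L s : ℕ}
    (hL : 0 < L) (hcyc : ∀ (v : V) (c : G.Walk v v), c.IsCycle → c.length < L) (hs : 0 < s) :
    ∀ (m : ℕ) (C : Finset V), C.card ≤ m → ∀ (w a : V) (p : G.Walk w a), p.IsPath → C ⊆ U →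
      (∀ x ∈ C, x ∉ p.support) → ClosedOff G U {v | v ∈ p.support} C →
      (∀ E ⊆ C, E.Nonempty → ClosedOff G U {v | v ∈ p.support} E → ∃ z ∈ E, G.Adj w z) →
      s ≤ 2 * C.card →
      ∃ D N : Finset V, D ⊆ U ∧ s ≤ 2 * D.card ∧ D.card ≤ s ∧ N.card ≤ L ∧
        ClosedOff G U N D := by
  intro m
  induction m with
  | zero => intro C hC; intros; omega
  | succ m ih =>
    intro C hCm w a p hp hCU hdisj hC hadj hsC
    obtain ⟨D, hDC, hDc, hDs, hD | ⟨hD, hirr⟩⟩ :=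
      exists_closedOff_small_or_irreducible hCU hC hdisj hsC
    · refine ⟨D, (Finset.range L).image p.getVert, hDC.trans hCU, hDs, hD, ?_, ?_⟩
      · exact Finset.card_image_le.trans (by simp)
      · exact closedOff_getVert_of_no_long_cycle hL hcyc p hp
          (fun x hx => hdisj x (hDC hx)) hDc (fun E hE => hadj E (hE.trans hDC))
    · obtain ⟨x, hx, hwx⟩ := hadj D hDC (Finset.card_pos.1 (by omega)) hDc
      have hsupp : {v | v ∈ (SimpleGraph.Walk.cons hwx.symm p).support} =
          insert x {v | v ∈ p.support} := by
        ext v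
        simp
      have hcard := Finset.card_erase_of_mem hx
      have hle := Finset.card_le_card hDC
      refine ih (D.erase x) (by omega) x a (SimpleGraph.Walk.cons hwx.symm p)
        ((SimpleGraph.Walk.cons_isPath_iff _ _).2 ⟨hp, hdisj x (hDC hx)⟩)
        ((Finset.erase_subset _ _).trans (hDC.trans hCU)) ?_ ?_ ?_ (by omega)
      · intro y hy hy'
        rw [SimpleGraph.Walk.support_cons, List.mem_cons] at hy'
        rw [Finset.mem_erase] at hy
        exact hy'.elim hy.1 (hdisj y (hDC hy.2))
      · rw [hsupp]
        exact hDc.erase x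
      · intro E hE hne hEc
        rw [hsupp] at hEc
        exact exists_adj_of_irreducible hx hirr hE hne hEc

/-- A graph without long cycles has small separators cutting off a part of prescribed size. -/
theorem exists_separation {G : SimpleGraph V} {U : Finset V} {L s : ℕ}
    (hL : 0 < L) (hcyc : ∀ (v : V) (c : G.Walk v v), c.IsCycle → c.length < L) (hs : 0 < s)
    (hU : s ≤ 2 * U.card) :
    ∃ D N : Finset V, D ⊆ U ∧ s ≤ 2 * D.card ∧ D.card ≤ s ∧ N.card ≤ L ∧ ClosedOff G U N D := by
  obtain ⟨D, hDU, hDc, hDs, hD | ⟨hD, hirr⟩⟩ :=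
    exists_closedOff_small_or_irreducible (G := G) (S := ∅) (Finset.Subset.refl U)
      (fun _ _ y hy _ => Or.inl hy) (fun _ _ => id) hU
  · exact ⟨D, ∅, hDU, hDs, hD, by simp, by simpa using hDc⟩
  · obtain ⟨w, hw⟩ : D.Nonempty := Finset.card_pos.1 (by omega)
    have hsupp : {v | v ∈ (SimpleGraph.Walk.nil : G.Walk w w).support} = insert w ∅ := by
      ext v
      simp
    have hcard := Finset.card_erase_of_mem hw
    refine exists_separation_of_path hL hcyc hs _ (D.erase w) le_rfl w w SimpleGraph.Walk.nil
      SimpleGraph.Walk.IsPath.nil ((Finset.erase_subset _ _).trans hDU) ?_ ?_ ?_ (by omega)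
    · intro y hy
      simpa using (Finset.mem_erase.1 hy).1
    · rw [hsupp]
      exact hDc.erase w
    · intro E hE hne hEc
      rw [hsupp] at hEc
      exact exists_adj_of_irreducible hw hirr hE hne hEc

/-- A locally sparse graph without long cycles is sparse. -/
theorem card_edges_le_of_no_long_cycle {G : SimpleGraph V} {M : Finset (Sym2 V)}
    (hM : ∀ e ∈ M, e ∈ G.edgeSet) {L s : ℕ} (hL : 0 < L) (hs : 0 < s)
    (hcyc : ∀ (v : V) (c : G.Walk v v), c.IsCycle → c.length < L) {c : ℝ} (hc : 0 ≤ c)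
    (hsparse : ∀ A : Finset V, A.card ≤ s + L → ((M ∩ A.sym2).card : ℝ) ≤ c * A.card) :
    ∀ (m : ℕ) (U : Finset V), U.card ≤ m →
      ((M ∩ U.sym2).card : ℝ) ≤ c * (1 + 2 * L / s) * U.card := by
  have hfac : c ≤ c * (1 + 2 * L / s) := by
    have : (0 : ℝ) ≤ 2 * L / s := by positivity
    nlinarith
  intro m
  induction m with
  | zero =>
    intro U hU
    refine (hsparse U (by omega)).trans ?_
    gcongr
  | succ m ih =>
    intro U hU
    by_cases hsmall : U.card ≤ s + L
    · refine (hsparse U hsmall).trans ?_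
      gcongr
    obtain ⟨D, N, hDU, hDs, hD, hN, hclosed⟩ := exists_separation (U := U) hL hcyc hs (by omega)
    -- Peel off `D`: the local bound handles `D ∪ N`, induction the rest. The overhead `|N| ≤ L` is
    -- charged to `|D| ≥ s / 2`, whence the factor `1 + 2 * L / s`.
    have hsub : M ∩ U.sym2 ⊆ (M ∩ (D ∪ N).sym2) ∪ (M ∩ (U \ D).sym2) := by
      intro e he
      induction e using Sym2.ind with
      | _ x y =>
        rw [Finset.mem_inter, Finset.mk_mem_sym2_iff] at he
        obtain ⟨heM, hx, hy⟩ := he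
        have hxy : G.Adj x y := hM _ heM
        simp only [Finset.mem_union, Finset.mem_inter, Finset.mk_mem_sym2_iff, heM, true_and,
          Finset.mem_sdiff, hx, hy]
        have h1 := hclosed x
        have h2 := hclosed y
        have h3 : x ∈ D → y ∈ D ∨ y ∈ N := fun h => by simpa using h1 h y hy hxy
        have h4 : y ∈ D → x ∈ D ∨ x ∈ N := fun h => by simpa using h2 h x hx hxy.symm
        tauto
    have hcardU : (U \ D).card + D.card = U.card := Finset.card_sdiff_add_card_eq_card hDU
    have hun := Finset.card_union_le D N
    have e1 := hsparse (D ∪ N) (by omega)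
    have e2 := ih (U \ D) (by omega)
    have e3 : ((M ∩ U.sym2).card : ℝ) ≤ (M ∩ (D ∪ N).sym2).card + (M ∩ (U \ D).sym2).card := by
      exact_mod_cast (Finset.card_le_card hsub).trans (Finset.card_union_le _ _)
    have hcard' : ((D ∪ N).card : ℝ) ≤ D.card + L := by exact_mod_cast hun.trans (by omega)
    have hUr : (U.card : ℝ) = (U \ D).card + D.card := by exact_mod_cast hcardU.symm
    have hL' : (L : ℝ) ≤ 2 * L / s * D.card := by
      have hs' : (0 : ℝ) < s := by exact_mod_cast hs
      have hDs' : (s : ℝ) ≤ 2 * D.card := by exact_mod_cast hDs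
      rw [div_mul_eq_mul_div, le_div_iff₀ hs']
      nlinarith [Nat.cast_nonneg (α := ℝ) L]
    have e4 : c * ((D ∪ N).card : ℝ) ≤ c * ((1 + 2 * L / s) * D.card) :=
      mul_le_mul_of_nonneg_left (by linarith) hc
    rw [hUr]
    linarith

end Separation

/-! ### Local sparsity from the potential -/

section LocalSparsity

/-- The sets of `k + ⌊k / Q⌋ + 1` pairs inside nonempty vertex sets of size `k ≤ R`. -/
def denseFamily (n R Q : ℕ) : Finset (Σ _ : Finset (Fin n), Finset (Sym2 (Fin n))) :=
  ((Finset.univ : Finset (Fin n)).powerset.filter fun A => 0 < A.card ∧ A.card ≤ R).sigma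
    fun A => A.sym2.powersetCard (A.card + (A.card / Q + 1))

theorem sum_range_one_fourth_pow_succ_lt_one (n : ℕ) :
    ∑ k ∈ Finset.range n, (1 / 4 : ℝ) ^ (k + 1) < 1 := by
  have h : ∀ n : ℕ, ∑ k ∈ Finset.range n, (1 / 4 : ℝ) ^ (k + 1) = (1 - (1 / 4) ^ n) / 3 := by
    intro n
    induction n with
    | zero => simp
    | succ n ih =>
      rw [Finset.sum_range_succ, ih]
      ring
  rw [h]
  have : (0 : ℝ) < (1 / 4) ^ n := by positivity
  linarith

theorem dangerPotential_denseFamily_lt_one {n R Q : ℕ} {K y x : ℝ} (hn : 0 < n) (hQ : 0 < Q)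
    (hK : 1 ≤ K) (hy : y * (36 * K) = 1) (hR : (R : ℝ) ≤ y ^ Q / K * n) (hx0 : 0 ≤ x)
    (hx : x ≤ K / n) :
    dangerPotential (denseFamily n R Q) (fun i => i.2) x ∅ < 1 := by
  let f : ℕ → ℝ := fun k => if 0 < k ∧ k ≤ R then
    (((k + 1).choose 2).choose (k + (k / Q + 1)) : ℝ) * x ^ (k + (k / Q + 1)) else 0
  have h1 : dangerPotential (denseFamily n R Q) (fun i => i.2) x ∅ =
      ∑ A ∈ (Finset.univ : Finset (Fin n)).powerset, f A.card := by
    rw [dangerPotential, denseFamily, Finset.sum_sigma, Finset.sum_filter]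
    refine Finset.sum_congr rfl fun A _ => ?_
    simp only [f]
    refine if_congr Iff.rfl ?_ rfl
    rw [Finset.sum_congr rfl (g := fun _ => x ^ (A.card + (A.card / Q + 1)))
      (fun F hF => by rw [Finset.sdiff_empty, (Finset.mem_powersetCard.1 hF).2]),
      Finset.sum_const, Finset.card_powersetCard, Finset.card_sym2, nsmul_eq_mul]
  rw [h1, Finset.sum_powerset_apply_card, Finset.card_univ, Fintype.card_fin,
    Finset.sum_range_succ']
  have h0 : n.choose 0 • f 0 = 0 := by simp [f]
  rw [h0, add_zero]
  refine lt_of_le_of_lt (Finset.sum_le_sum fun k _ => ?_) (sum_range_one_fourth_pow_succ_lt_one n)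
  simp only [f, nsmul_eq_mul]
  split_ifs with hk
  · rw [← mul_assoc]
    refine le_trans ?_ (choose_mul_choose_mul_pow_le (j := (k + 1) / Q + 1) (Q := Q) hn hk.1 hK hy ?_ ?_)
    · gcongr
    · exact (Nat.lt_mul_div_succ (k + 1) hQ).le
    · exact le_trans (by exact_mod_cast hk.2) hR
  · rw [mul_zero]
    positivity

theorem card_inter_sym2_le_of_dangerPotential_lt_one {n R Q : ℕ}
    {M : Finset (Sym2 (Fin n))}
    (hM : dangerPotential (denseFamily n R Q) (fun i => i.2) 0 M < 1)
    (A : Finset (Fin n)) (hA : A.card ≤ R) :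
    ((M ∩ A.sym2).card : ℝ) ≤ (1 + 1 / Q) * A.card := by
  obtain rfl | hne := A.eq_empty_or_nonempty
  · simp
  by_cases hle : (M ∩ A.sym2).card ≤ A.card + A.card / Q
  · have h1 : ((M ∩ A.sym2).card : ℝ) ≤ A.card + ((A.card / Q : ℕ) : ℝ) := by exact_mod_cast hle
    have h2 : ((A.card / Q : ℕ) : ℝ) ≤ A.card / Q := Nat.cast_div_le
    calc ((M ∩ A.sym2).card : ℝ) ≤ A.card + A.card / Q := by linarith
      _ = (1 + 1 / Q) * A.card := by ring
  · exfalso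
    obtain ⟨F, hF, hcard⟩ := Finset.exists_subset_card_eq
      (s := M ∩ A.sym2) (n := A.card + (A.card / Q + 1)) (by omega)
    have hmem : (⟨A, F⟩ : Σ _ : Finset (Fin n), Finset (Sym2 (Fin n))) ∈ denseFamily n R Q := by
      rw [denseFamily, Finset.mem_sigma, Finset.mem_filter, Finset.mem_powersetCard]
      exact ⟨⟨Finset.mem_powerset.2 (Finset.subset_univ A), hne.card_pos, hA⟩,
        hF.trans Finset.inter_subset_right, hcard⟩
    have h1 := Finset.single_le_sum (s := denseFamily n R Q)
      (f := fun i => (0 : ℝ) ^ (i.2 \ M).card) (fun i _ => by positivity) hmem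
    -- At parameter `0` a fully claimed set contributes `0 ^ 0 = 1`.
    have h2 : F \ M = ∅ := Finset.sdiff_eq_empty_iff_subset.2 (hF.trans Finset.inter_subset_left)
    simp only [h2, Finset.card_empty, pow_zero] at h1
    exact absurd hM (not_lt.2 h1)

end LocalSparsity

/-! ### Combining strategy, sparsity and separators -/

theorem HasCycleOfLengthAtLeast.mono {V : Type*} {G H : SimpleGraph V} {L : ℝ} (hGH : G ≤ H)
    (hG : HasCycleOfLengthAtLeast G L) : HasCycleOfLengthAtLeast H L := by
  obtain ⟨v, p, hp, hL⟩ := hG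
  exact ⟨v, p.mapLe hGH, hp.mapLe hGH, by simpa using hL⟩

/-- A locally sparse graph that is globally denser contains a cycle of linear length. -/
theorem hasCycleOfLengthAtLeast_of_sparse {V : Type*} [Fintype V] [DecidableEq V]
    {G : SimpleGraph V} {M : Finset (Sym2 V)} {ε β c : ℝ} (hε : 0 < ε) (hε1 : ε < 1) (hβ : 0 < β)
    (hM : ∀ e ∈ M, e ∈ G.edgeSet) (hV : 128 ≤ β * ε * Fintype.card V) (hc : 0 ≤ c)
    (hcε : c ≤ 1 + ε / 8)
    (hsparse : ∀ A : Finset V, (A.card : ℝ) ≤ β * Fintype.card V →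
      ((M ∩ A.sym2).card : ℝ) ≤ c * A.card)
    (hcard : (1 + ε / 2) * Fintype.card V ≤ M.card) :
    HasCycleOfLengthAtLeast G (β * ε / 128 * Fintype.card V) := by
  have hcardU := Finset.card_univ (α := V)
  generalize Fintype.card V = n at *
  have hn0 : (0 : ℝ) < n := by
    by_contra! h
    nlinarith [mul_pos hβ hε]
  have hβn0 : 0 < β * n := mul_pos hβ hn0
  have hβn : 128 ≤ β * n := by nlinarith
  have hβεn : β * ε * n ≤ β * n := by nlinarith
  by_contra hcon
  obtain ⟨L, hL⟩ : ∃ L, L = ⌈β * ε / 128 * (n : ℝ)⌉₊ := ⟨_, rfl⟩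
  have hLhigh : (L : ℝ) < β * ε / 128 * n + 1 := hL ▸ Nat.ceil_lt_add_one (by positivity)
  have hL0 : 0 < L := hL ▸ Nat.ceil_pos.2 (by positivity)
  -- This gives both `s + L ≤ β n`, so the local bound applies, and `2 * L / s ≤ ε / 8`.
  obtain ⟨s, hs⟩ : ∃ s, s = ⌊β * n / 2⌋₊ := ⟨_, rfl⟩
  have hsle : (s : ℝ) ≤ β * n / 2 := hs ▸ Nat.floor_le (by positivity)
  have hslow : β * n / 2 < s + 1 := hs ▸ Nat.lt_floor_add_one _
  have hs0 : (0 : ℝ) < s := by linarith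
  have hcyc : ∀ (v : V) (p : G.Walk v v), p.IsCycle → p.length < L :=
    fun v p hp => hL ▸ Nat.lt_ceil.2 (not_le.1 fun hle => hcon ⟨v, p, hp, hle⟩)
  have hmain := card_edges_le_of_no_long_cycle hM hL0 (by exact_mod_cast hs0) hcyc hc
    (fun A hA => hsparse A (by
      have : (A.card : ℝ) ≤ s + L := by exact_mod_cast hA
      linarith)) _ Finset.univ le_rfl
  rw [Finset.sym2_univ, Finset.inter_univ, hcardU] at hmain
  have hLs : (2 * L / s : ℝ) ≤ ε / 8 := by
    rw [div_le_iff₀ hs0]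
    have h1 : ε * (β * n / 4) ≤ ε * s := mul_le_mul_of_nonneg_left (by linarith) hε.le
    linarith
  have hprod : c * (1 + 2 * L / s) ≤ (1 + ε / 8) * (1 + ε / 8) := by
    gcongr
  have hlt : (1 + ε / 8) * (1 + ε / 8) < 1 + ε / 2 := by
    have : ε * ε < 1 * ε := mul_lt_mul_of_pos_right hε1 hε
    linarith
  have := mul_lt_mul_of_pos_right (hprod.trans_lt hlt) hn0
  linarith

/-- Maker has enough free edges to choose from during the first `(1 + ε / 2) n` rounds. -/
theorem le_mul_card_freeEdges {n b : ℕ} {ε : ℝ} (hε : 0 < ε) (hε1 : ε < 1)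
    (hn : 20 ≤ ε * n) (hb : (b : ℝ) ≤ (1 - ε) * n / 2) {h : History n} (hp : IsPlay b h)
    (hlen : (h.length : ℝ) ≤ (1 + ε / 2) * n) :
    1 ≤ 8 / (ε * (n : ℝ) ^ 2) * (freeEdges h).card := by
  have hn0 : (0 : ℝ) < n := by
    by_contra! hcon
    nlinarith
  have h1 : ((n.choose 2 : ℕ) : ℝ) ≤ (freeEdges h).card + ((b : ℝ) + 1) * h.length := by
    exact_mod_cast choose_two_le_card_freeEdges_add hp
  rw [Nat.cast_choose_two] at h1
  have h2 : ((b : ℝ) + 1) * h.length ≤ ((1 - ε) * n / 2 + 1) * ((1 + ε / 2) * n) := by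
    have : 0 ≤ 1 - ε := by linarith
    gcongr
  rw [div_mul_eq_mul_div, le_div_iff₀ (by positivity)]
  have h3 : 20 * (n : ℝ) ≤ ε * n ^ 2 := by nlinarith
  have h4 : 0 ≤ ε ^ 2 * (n : ℝ) ^ 2 := by positivity
  nlinarith

theorem makerWins_long_cycle {n b Q : ℕ} {ε K y β : ℝ} (hε : 0 < ε) (hε1 : ε < 1) (hQ : 0 < Q)
    (hQε : 8 ≤ Q * ε) (hK : K = 16 / ε) (hy : y * (36 * K) = 1) (hβ : β = y ^ Q / K)
    (hn : 128 ≤ β * ε * n) (hb : (b : ℝ) ≤ (1 - ε) * n / 2) :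
    MakerWins n b fun G => HasCycleOfLengthAtLeast G (β * ε / 128 * n) := by
  have hK1 : 16 ≤ K := by
    rw [hK, le_div_iff₀ hε]
    linarith
  have hK0 : 0 < K := by linarith
  have hy0 : 0 < y := by
    by_contra! h
    nlinarith
  have hβ0 : 0 < β := by rw [hβ]; positivity
  have hβ1 : β ≤ 1 := by
    rw [hβ, div_le_one hK0]
    have : y ^ Q ≤ 1 := pow_le_one₀ hy0.le (by nlinarith)
    linarith
  have hn0 : (0 : ℝ) < n := by
    by_contra! h
    nlinarith [mul_pos hβ0 hε]
  have hnat : 0 < n := by exact_mod_cast hn0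
  have hεn : 128 ≤ ε * n := by nlinarith [mul_pos hε hn0]
  set T := ⌈(1 + ε / 2) * (n : ℝ)⌉₊ with hT
  have hTlow : (1 + ε / 2) * (n : ℝ) ≤ T := Nat.le_ceil _
  have hThigh : (T : ℝ) < (1 + ε / 2) * n + 1 := Nat.ceil_lt_add_one (by positivity)
  set q : ℝ := 8 / (ε * (n : ℝ) ^ 2) with hq
  have hq0 : 0 ≤ q := by positivity
  have hfree : ∀ h : History n, IsPlay b h → h.length < T → 1 ≤ q * (freeEdges h).card :=
    fun h hp hlt => le_mul_card_freeEdges hε hε1 (by linarith) hb hp (Nat.lt_ceil.1 hlt).le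
  have hTq : T * q ≤ K / n := by
    rw [hq, hK, mul_div_assoc', div_div, div_le_div_iff₀ (by positivity) (by positivity)]
    have hT2 : (T : ℝ) ≤ 2 * n := by nlinarith
    have h3 : 0 ≤ 8 * (ε * n : ℝ) := by positivity
    nlinarith [mul_le_mul_of_nonneg_right hT2 h3]
  set R := ⌊β * n⌋₊ with hR
  have hRβ : (R : ℝ) ≤ y ^ Q / K * n := hβ ▸ Nat.floor_le (by positivity)
  have hstart := dangerPotential_denseFamily_lt_one hnat hQ (by linarith) hy hRβ
    (mul_nonneg (Nat.cast_nonneg T) hq0) hTq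
  obtain ⟨σ, hσ⟩ := exists_strategy_dangerPotential_le (b := b) (denseFamily n R Q)
    (fun i => i.2) hnat hq0 T hfree
  refine ⟨σ, fun h hp hover hf => ?_⟩
  have hlen : T ≤ h.length := by
    by_contra! hlt
    have := hfree h hp hlt
    rw [IsOver] at hover
    norm_num [hover] at this
  -- Histories list the latest round first, so `g` consists of the first `T` rounds; later Maker
  -- edges cannot destroy the cycle.
  set g := h.drop (h.length - T) with hg
  have hgT : g.length = T := by
    rw [hg, List.length_drop]
    omega
  have hgp : IsPlay b g := hp.drop _
  have hle : makerGraph g ≤ makerGraph h := SimpleGraph.fromEdgeSet_mono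
    (Finset.coe_subset.2 (makerEdges_drop_subset h _))
  have hpot := (hσ g hgp (hf.drop _) hgT.le).trans_lt hstart
  rw [hgT, Nat.sub_self, Nat.cast_zero, zero_mul] at hpot
  have hsparse := card_inter_sym2_le_of_dangerPotential_lt_one hpot
  refine HasCycleOfLengthAtLeast.mono hle ?_
  have hcard : (Fintype.card (Fin n) : ℝ) = n := by rw [Fintype.card_fin]
  rw [← hcard] at hn hTlow ⊢
  refine hasCycleOfLengthAtLeast_of_sparse (G := makerGraph g) (M := makerEdges g) (c := 1 + 1 / Q) hε hε1 hβ0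
    (fun e he => ?_) hn (by positivity) ?_
    (fun A hA => hsparse A (Nat.le_floor (by rwa [hcard] at hA))) ?_
  · rw [makerGraph, SimpleGraph.edgeSet_fromEdgeSet]
    exact ⟨he, not_isDiag_of_mem_makerEdges hgp e he⟩
  · have : (1 : ℝ) / Q ≤ ε / 8 := by
      rw [div_le_div_iff₀ (by exact_mod_cast hQ) (by norm_num)]
      linarith
    linarith
  · rwa [card_makerEdges hgp, hgT]

end MakerBreaker

theorem theorem6 :
    ∀ ε : ℝ, 0 < ε → ε < 1 →
      ∃ δ : ℝ, 0 < δ ∧ ∃ n₀ : ℕ, ∀ n : ℕ, n₀ < n →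
        ∀ b : ℕ, 1 ≤ b → (b : ℝ) ≤ (1 - ε) * (n : ℝ) / 2 →
          MakerBreaker.MakerWins n b
            (fun G => MakerBreaker.HasCycleOfLengthAtLeast G (δ * (n : ℝ))) := by
  intro ε hε hε1
  obtain ⟨Q, hQ⟩ := exists_nat_ge (8 / ε)
  have hQ0 : 0 < Q := by
    have : (0 : ℝ) < Q := lt_of_lt_of_le (by positivity) hQ
    exact_mod_cast this
  have hβ0 : 0 < (1 / (36 * (16 / ε))) ^ Q / (16 / ε) := by positivity
  obtain ⟨n₀, hn₀⟩ := exists_nat_ge (128 / ((1 / (36 * (16 / ε))) ^ Q / (16 / ε) * ε))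
  refine ⟨(1 / (36 * (16 / ε))) ^ Q / (16 / ε) * ε / 128, by positivity, n₀,
    fun n hn b _ hb => ?_⟩
  refine MakerBreaker.makerWins_long_cycle hε hε1 hQ0 ((div_le_iff₀ hε).1 hQ) rfl
    (one_div_mul_cancel (by positivity)) rfl ?_ hb
  rw [div_le_iff₀ (by positivity)] at hn₀
  have hn' : (n₀ : ℝ) ≤ n := by exact_mod_cast hn.le
  nlinarith [mul_le_mul_of_nonneg_right hn' (mul_pos hβ0 hε).le]
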